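/- Let $n\ge 0$ and $A=\{x_1^{\pm1},\dots,x_n^{\pm1}\}$, regarded as a formal alphabet with $2n$ letters. There is a uniform partial algorithm (a partial recursive function) which takes as input (i) a finite presentation $G=\langle x_1,\dots,x_n\mid r_1,\dots,r_m\rangle$ of a group $G$; (ii) an automatic structure with uniqueness $(L=L(M),A,M_=,M_{x_1},\dots,M_{x_n^{-1}})$ for $G$, given explicitly by its automata; that is, $M$ is a finite state automaton over $A$ whose language $L$ contains, for every $g\in G$, exactly one word $w$ with $\pi(w)=g$, where $\pi\colon A^*\to G$ is the natural monoid homomorphism, $M_=$ is a finite state automaton recognizing the padded pairs $(w,u)$ of words $w,u\in L$ with $\pi(w)=\pi(u)$, and for every $a\in A$, $M_a$ is a finite state automaton recognizing the padded pairs $(w,u)$ of words $w,u\in L$ with $\pi(wa)=\pi(u)$ (in a padded pair the two words are read synchronously, the shorter one being filled up at its end with a padding symbol); (iii) finitely many words $v_1,\dots,v_t\in A^*$, and which, for the subgroup $H\le G$ generated by $\pi(v_1),\dots,\pi(v_t)$ and the language $L_H=\pi^{-1}(H)\cap L$, will (a) eventually stop and produce a finite state automaton $M_H$ recognizing $L_H$,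 when $H$ is $L$-rational, i.e. when $L_H$ is a regular language; (b) run forever when $H$ is not $L$-rational. In particular, for every fixed $G$ and every fixed automatic structure with uniqueness for $G$ there is such an algorithm that takes only the words $v_1,\dots,v_t$ as input. -/

import Mathlib

/-- The formal alphabet `A = {x₁^{±1}, …, xₙ^{±1}}`: the letter `(i, true)` stands for `xᵢ` and
`(i, false)` for `xᵢ⁻¹` (the convention of `FreeGroup.mk`). -/
abbrev Letter (n : ℕ) := Fin n × Bool

/-- Words over the alphabet `A`. -/
abbrev GWord (n : ℕ) := List (Letter n)

/-- The group `⟨x₁, …, xₙ | r₁, …, rₘ⟩` given by a finite presentation with relators the words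
of the list `R`. -/
abbrev FinPresGroup {n : ℕ} (R : List (GWord n)) :=
  PresentedGroup {r : FreeGroup (Fin n) | ∃ w ∈ R, r = FreeGroup.mk w}

/-- The natural map `π : A* → G`. -/
def wordValue {n : ℕ} (R : List (GWord n)) (w : GWord n) : FinPresGroup R :=
  PresentedGroup.mk _ (FreeGroup.mk w)

/-- An explicit (finitely coded) deterministic finite state automaton over the alphabet `α`.
The states are `0, …, numStates - 1` where `numStates = lastState + 1`, the initial state is `0`,
`transitions` is an association list sending pairs (state, letter) to states, and `accepting` is
the list of accept states. -/
structure FSACode (α : Type) where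
  lastState : ℕ
  transitions : List ((ℕ × α) × ℕ)
  accepting : List ℕ

namespace FSACode

/-- A code is a tuple of its components. -/
def equivProd (α : Type) : FSACode α ≃ ℕ × List ((ℕ × α) × ℕ) × List ℕ where
  toFun M := (M.lastState, M.transitions, M.accepting)
  invFun t := ⟨t.1, t.2.1, t.2.2⟩
  left_inv _ := rfl
  right_inv _ := rfl

instance instPrimcodable {α : Type} [Primcodable α] : Primcodable (FSACode α) :=
  Primcodable.ofEquiv _ (equivProd α)

/-- The deterministic finite automaton described by a code. A transition that is missing from the
list leads to state `0`, and state numbers are read modulo the number of states, so that every code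
describes an automaton. -/
def toDFA {α : Type} [DecidableEq α] (M : FSACode α) : DFA α (Fin (M.lastState + 1)) where
  step q a := Fin.ofNat (M.lastState + 1) ((M.transitions.lookup (q.val, a)).getD 0)
  start := 0
  accept := {q | q.val ∈ M.accepting}

/-- The language recognized by the automaton. -/
def language {α : Type} [DecidableEq α] (M : FSACode α) : Language α := M.toDFA.accepts

end FSACode

/-- The padded pair of two words: both words are read synchronously, and the shorter one is
padded at its end by the padding symbol `none`. -/
def padPair {α : Type} (u v : List α) : List (Option α × Option α) :=
  List.zipWithAll Prod.mk u v

/-- The explicit finite data: relators over `x₁, …, xₙ`, a finite automaton `M` over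
`A`, and the comparison automata `M₌`, `M_{xᵢ}`, `M_{xᵢ⁻¹}` reading padded pairs of words. -/
structure AutomaticData (n : ℕ) where
  relators : List (GWord n)
  wordAcceptor : FSACode (Letter n)
  equalityAut : FSACode (Option (Letter n) × Option (Letter n))
  genAut : Fin n → FSACode (Option (Letter n) × Option (Letter n))
  genInvAut : Fin n → FSACode (Option (Letter n) × Option (Letter n))

namespace AutomaticData

/-- The data is a tuple of its components. -/
def equivProd (n : ℕ) : AutomaticData n ≃
    List (GWord n) × FSACode (Letter n) × FSACode (Option (Letter n) × Option (Letter n)) ×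
      (Fin n → FSACode (Option (Letter n) × Option (Letter n))) ×
      (Fin n → FSACode (Option (Letter n) × Option (Letter n))) where
  toFun D := (D.relators, D.wordAcceptor, D.equalityAut, D.genAut, D.genInvAut)
  invFun t := ⟨t.1, t.2.1, t.2.2.1, t.2.2.2.1, t.2.2.2.2⟩
  left_inv _ := rfl
  right_inv _ := rfl

instance instPrimcodable {n : ℕ} : Primcodable (AutomaticData n) :=
  Primcodable.ofEquiv _ (equivProd n)

variable {n : ℕ}

/-- The presented group `G`. -/
abbrev Grp (D : AutomaticData n) := FinPresGroup D.relators

/-- The map `π : A* → G`. -/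
def value (D : AutomaticData n) (w : GWord n) : D.Grp := wordValue D.relators w

/-- The language `L = L(M)`. -/
def lang (D : AutomaticData n) : Language (Letter n) := D.wordAcceptor.language

/-- The comparison automaton of a letter. -/
def letterAut (D : AutomaticData n) : Letter n → FSACode (Option (Letter n) × Option (Letter n))
  | (i, true) => D.genAut i
  | (i, false) => D.genInvAut i

/-- The padded pairs `(w, u)` of words of `L` with `π(w s) = π(u)`. -/
def comparisonLanguage (D : AutomaticData n) (s : GWord n) :
    Language (Option (Letter n) × Option (Letter n)) :=
  {p | ∃ w ∈ D.lang, ∃ u ∈ D.lang, D.value (w ++ s) = D.value u ∧ p = padPair w u}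

/-- The data is an automatic structure with uniqueness for the presented group `G`: every element
of `G` is represented by exactly one word of `L`, `M₌` recognizes the pairs of words of `L` with
equal values, and for each letter `a`, `M_a` recognizes the pairs `(w, u)` of words of `L` with
`π(w a) = π(u)`. -/
structure IsAutomaticWithUniqueness (D : AutomaticData n) : Prop where
  existsUnique : ∀ g : D.Grp, ∃! w : GWord n, w ∈ D.lang ∧ D.value w = g
  equality : D.equalityAut.language = D.comparisonLanguage []
  multiplier : ∀ a : Letter n, (D.letterAut a).language = D.comparisonLanguage [a]

/-- The subgroup `H` of `G` generated by the elements represented by the words of `vs`. -/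
def subgroupOf (D : AutomaticData n) (vs : List (GWord n)) : Subgroup D.Grp :=
  Subgroup.closure {g | ∃ v ∈ vs, g = D.value v}

/-- The full preimage `L_H = π⁻¹(H) ∩ L` of a subgroup `H` in `L`. -/
def preimageLang (D : AutomaticData n) (H : Subgroup D.Grp) : Language (Letter n) :=
  {w | w ∈ D.lang ∧ D.value w ∈ H}

/-- The subgroup `H` is `L`-rational: `L_H` is a regular language. -/
def IsRational (D : AutomaticData n) (H : Subgroup D.Grp) : Prop :=
  (D.preimageLang H).IsRegular

end AutomaticData

/-!
The language `L_H` is characterized by data that can be checked mechanically, so the algorithm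
enumerates all pairs of an automaton `M` and a *certificate*, and outputs the first `M` whose
certificate is valid. It then suffices that a valid certificate forces `L(M) = L_H`
(`Certifies.language_eq`), that a certificate exists whenever `L_H` is regular
(`exists_certifies`), and that validity is primitive recursive (`primrecPred_certifies`).

A certificate has two parts. The first shows `L(M) ⊆ L_H`. If `L(M) = L_H`, then two words that lead
to the same state of `M`, from which an accept state can be reached, represent the same coset of
`H`. So the states can be labelled by coset representatives, and only finitely many relations
`H s a = H s'` have to be verified. Each is witnessed by an expression of a word as a product of
generators of `H` and of conjugates of relators, checked by free reduction (`IsLabelling`,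
`exists_isLabelling`). The word acceptor is run along to see that `L(M) ⊆ L`.

The second part shows `L_H ⊆ L(M)`. As `L(M)` contains the representative of some element of `H`, it
is enough that `L(M)` is closed under right multiplication by each word `v` among the generators
and their inverses. This is split into single letters: for each prefix `p` of `v` an automaton for
the representatives of the coset `H p` is given, and the comparison automaton of a letter `a` is
used to see that multiplication by `a` takes the automaton of `p` to that of `p a` (`IsEdge`,
`pathSources`). These languages are regular when `L_H` is, since the image of a regular
language under a regular relation is regular (`Language.IsRegular.image_tapes`). Every claim about
all words read by finitely many automata is certified by a finite invariant set of tuples of states,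
so that nothing about the automata has to be decided by search.
-/

/-! ### Finite automata given by codes -/

namespace FSACode

variable {α : Type} [DecidableEq α]

/-- The transition function of a code, with states read as plain natural numbers. -/
def next (M : FSACode α) (q : ℕ) (a : α) : ℕ :=
  ((M.transitions.lookup (q, a)).getD 0) % (M.lastState + 1)

/-- The state, as a natural number, which the automaton reaches after reading a word. -/
def run (M : FSACode α) (w : List α) : ℕ := w.foldl M.next 0

@[simp] theorem run_nil (M : FSACode α) : M.run [] = 0 := rfl

@[simp] theorem run_append_singleton (M : FSACode α) (w : List α) (a : α) :
    M.run (w ++ [a]) = M.next (M.run w) a := by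
  simp [run]

theorem run_append_congr (M : FSACode α) {u v : List α} (h : M.run u = M.run v) (t : List α) :
    M.run (u ++ t) = M.run (v ++ t) := by
  simp only [run, List.foldl_append] at h ⊢
  rw [h]

theorem eval_val (M : FSACode α) (w : List α) : (M.toDFA.eval w).val = M.run w := by
  induction w using List.reverseRecOn with
  | nil => rfl
  | append_singleton w a ih =>
    rw [DFA.eval_append_singleton, run_append_singleton, ← ih]
    rfl

theorem mem_language (M : FSACode α) (w : List α) :
    w ∈ M.language ↔ M.run w ∈ M.accepting := by
  rw [← eval_val]
  rfl

theorem run_lt (M : FSACode α) (w : List α) : M.run w < M.lastState + 1 := by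
  rw [← eval_val]
  exact (M.toDFA.eval w).isLt

theorem isRegular_language (M : FSACode α) : M.language.IsRegular :=
  ⟨_, inferInstance, M.toDFA, rfl⟩

/-- Every regular language over a finite alphabet is recognized by some code. -/
theorem exists_language_eq [Fintype α] {L : Language α} (hL : L.IsRegular) :
    ∃ M : FSACode α, M.language = L := by
  classical
  obtain ⟨σ, _, A, rfl⟩ := hL
  have : Nonempty σ := ⟨A.start⟩
  obtain ⟨k, hk⟩ : ∃ k, Fintype.card σ = k + 1 :=
    Nat.exists_eq_succ_of_ne_zero Fintype.card_ne_zero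
  -- a numbering of the states which gives the initial state the number `0`
  let e₀ : σ ≃ Fin (k + 1) := (Fintype.equivFin σ).trans (finCongr hk)
  let e : σ ≃ Fin (k + 1) := e₀.trans (Equiv.swap (e₀ A.start) 0)
  have he : e A.start = 0 := by simp [e]
  let table : List ((ℕ × α) × ℕ) :=
    (Finset.univ : Finset (σ × α)).toList.map fun p => (((e p.1).val, p.2), (e (A.step p.1 p.2)).val)
  have lookup_of_mem : ∀ (l : List (σ × α)) (q : σ) (a : α), (q, a) ∈ l →
      (l.map fun p => (((e p.1).val, p.2), (e (A.step p.1 p.2)).val)).lookup ((e q).val, a)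
        = some (e (A.step q a)).val := by
    intro l q a
    induction l with
    | nil => simp
    | cons p l ih =>
      intro h
      by_cases hp : p = (q, a)
      · subst hp
        simp
      · have hne : (((e q).val, a) == ((e p.1).val, p.2)) = false := by
          rw [beq_eq_false_iff_ne]
          intro hh
          rw [Prod.mk.injEq] at hh
          exact hp (Prod.ext (e.injective (Fin.ext hh.1)).symm hh.2.symm)
        rw [List.map_cons, List.lookup_cons, hne]
        rcases List.mem_cons.1 h with h | h
        · exact absurd h.symm hp
        · exact ih h
  let M : FSACode α :=
    ⟨k, table, (Finset.univ : Finset σ).toList.filterMap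
      fun q => if q ∈ A.accept then some (e q).val else none⟩
  have hrun : ∀ w, M.run w = (e (A.eval w)).val := by
    intro w
    induction w using List.reverseRecOn with
    | nil => simp [he]
    | append_singleton w a ih =>
      rw [run_append_singleton, ih, DFA.eval_append_singleton, next,
        lookup_of_mem _ _ _ (Finset.mem_toList.2 (Finset.mem_univ _))]
      exact Nat.mod_eq_of_lt (Fin.isLt _)
  refine ⟨M, ?_⟩
  ext w
  rw [mem_language, hrun, DFA.mem_accepts]
  constructor
  · intro h
    obtain ⟨q, -, hq⟩ := List.mem_filterMap.1 h
    split_ifs at hq with hacc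
    rwa [← e.injective (Fin.ext (Option.some.inj hq))]
  · intro h
    exact List.mem_filterMap.2 ⟨_, Finset.mem_toList.2 (Finset.mem_univ _), by rw [if_pos h]⟩

/-- The transition function of an automaton on one tape of a padded pair: it does not move on
the padding symbol. -/
def tapeNext (M : FSACode α) (q : ℕ) : Option α → ℕ
  | none => q
  | some a => M.next q a

theorem run_tape_append_singleton {β : Type} (M : FSACode α) (t : β → Option α) (x : List β)
    (b : β) :
    M.run ((x ++ [b]).filterMap t) = M.tapeNext (M.run (x.filterMap t)) (t b) := by
  cases h : t b with
  | none => simp [h, tapeNext]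
  | some a => simp [h, tapeNext]

end FSACode

section PaddedPairs

variable {α : Type}

@[simp] theorem filterMap_fst_padPair (u v : List α) : (padPair u v).filterMap Prod.fst = u := by
  induction u generalizing v with
  | nil => induction v with
    | nil => rfl
    | cons b v ih => simp [padPair]
  | cons a u ih => cases v with
    | nil => simp [padPair]
    | cons b v => simpa [padPair] using ih v

@[simp] theorem filterMap_snd_padPair (u v : List α) : (padPair u v).filterMap Prod.snd = v := by
  induction u generalizing v with
  | nil => induction v with
    | nil => rfl
    | cons b v ih => simp [padPair]
  | cons a u ih => cases v with
    | nil => simp [padPair]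
    | cons b v => simpa [padPair] using ih v

/-- The image of a regular language under a regular relation is regular. The relation is given by a
regular language of words over a larger alphabet with two tapes `s` and `t`, and the left quotient
of the image by `u` depends only on the set of pairs of states that are reachable by words with
second tape `u`. -/
theorem Language.IsRegular.image_tapes {β γ : Type} {K : Language α} {R : Language β}
    (hK : K.IsRegular) (hR : R.IsRegular) (s : β → Option α) (t : β → Option γ) {J : Language γ}
    (hJ : ∀ u, u ∈ J ↔ ∃ x ∈ R, x.filterMap s ∈ K ∧ x.filterMap t = u) : J.IsRegular := by
  obtain ⟨σ, _, A, rfl⟩ := hK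
  obtain ⟨τ, _, B, rfl⟩ := hR
  refine Language.isRegular_iff_finite_range_leftQuotient.2 ?_
  let reach : List γ → Set (σ × τ) := fun u =>
    {p | ∃ x : List β, x.filterMap t = u ∧ p = (A.eval (x.filterMap s), B.eval x)}
  let quot : Set (σ × τ) → Language γ := fun S =>
    {u | ∃ p ∈ S, ∃ y : List β, y.filterMap t = u ∧
      A.evalFrom p.1 (y.filterMap s) ∈ A.accept ∧ B.evalFrom p.2 y ∈ B.accept}
  refine (Set.finite_range quot).subset ?_
  rintro _ ⟨u, rfl⟩
  refine ⟨reach u, ?_⟩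
  ext u'
  rw [Language.mem_leftQuotient, hJ]
  constructor
  · rintro ⟨_, ⟨x, hx, rfl⟩, y, hy, h1, h2⟩
    refine ⟨x ++ y, ?_, ?_, ?_⟩
    · rw [DFA.mem_accepts, DFA.eval, DFA.evalFrom_of_append]
      exact h2
    · rw [List.filterMap_append, DFA.mem_accepts, DFA.eval, DFA.evalFrom_of_append]
      exact h1
    · rw [List.filterMap_append, hx, hy]
  · rintro ⟨z, hz, h1, h2⟩
    obtain ⟨x, y, rfl, hx, hy⟩ := List.filterMap_eq_append_iff.1 h2
    rw [List.filterMap_append, DFA.mem_accepts, DFA.eval, DFA.evalFrom_of_append] at h1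
    rw [DFA.mem_accepts, DFA.eval, DFA.evalFrom_of_append] at hz
    exact ⟨_, ⟨x, hx, rfl⟩, y, hy, h1, hz⟩

end PaddedPairs

/-! ### Words and membership in the subgroup -/

namespace AutomaticData

variable {n : ℕ}

@[simp] theorem value_nil (D : AutomaticData n) : D.value [] = 1 := rfl

@[simp] theorem value_append (D : AutomaticData n) (u v : GWord n) :
    D.value (u ++ v) = D.value u * D.value v := by
  simp only [value, wordValue, ← FreeGroup.mul_mk, map_mul]

@[simp] theorem value_invRev (D : AutomaticData n) (u : GWord n) :
    D.value (FreeGroup.invRev u) = (D.value u)⁻¹ := by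
  simp only [value, wordValue, ← FreeGroup.inv_mk, map_inv]

/-- A list of words together with their formal inverses. -/
def symmetrize (l : List (GWord n)) : List (GWord n) := l ++ l.map FreeGroup.invRev

theorem mem_symmetrize_of_mem {l : List (GWord n)} {w : GWord n} (h : w ∈ l) :
    w ∈ symmetrize l := List.mem_append_left _ h

theorem invRev_mem_symmetrize {l : List (GWord n)} {w : GWord n} (h : w ∈ l) :
    FreeGroup.invRev w ∈ symmetrize l := List.mem_append_right _ (List.mem_map_of_mem h)

/-- A formal product of conjugates: the list of pairs `(x, r)` stands for the product of the
words `x r x⁻¹`. -/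
abbrev Derivation (n : ℕ) := List (GWord n × GWord n)

/-- The word `x₁ r₁ x₁⁻¹ x₂ r₂ x₂⁻¹ ⋯` of a formal product of conjugates. -/
def derivationWord (d : Derivation n) : GWord n :=
  d.flatMap fun p => p.1 ++ p.2 ++ FreeGroup.invRev p.1

/-- The factors are conjugates of relators or generators of the subgroup, or inverses of such. -/
def IsDerivation (D : AutomaticData n) (vs : List (GWord n)) (d : Derivation n) : Prop :=
  ∀ p ∈ d, p.2 ∈ symmetrize D.relators ∨ (p.1 = [] ∧ p.2 ∈ symmetrize vs)

/-- Some formal product in the list `C` is freely equal to the word `w` and shows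
that `π(w)` lies in the subgroup generated by `vs`. -/
def Derives (D : AutomaticData n) (vs : List (GWord n)) (C : List (Derivation n))
    (w : GWord n) : Prop :=
  ∃ d ∈ C, D.IsDerivation vs d ∧ FreeGroup.reduce w = FreeGroup.reduce (derivationWord d)

theorem derivationWord_append (d e : Derivation n) :
    derivationWord (d ++ e) = derivationWord d ++ derivationWord e := by
  simp [derivationWord]

theorem IsDerivation.append {D : AutomaticData n} {vs : List (GWord n)} {d e : Derivation n}
    (hd : D.IsDerivation vs d) (he : D.IsDerivation vs e) : D.IsDerivation vs (d ++ e) := by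
  intro p hp
  exact (List.mem_append.1 hp).elim (hd p) (he p)

theorem value_mem_subgroupOf_of_mem_symmetrize (D : AutomaticData n) {vs : List (GWord n)}
    {v : GWord n} (hv : v ∈ symmetrize vs) : D.value v ∈ D.subgroupOf vs := by
  rcases List.mem_append.1 hv with h | h
  · exact Subgroup.subset_closure ⟨v, h, rfl⟩
  · obtain ⟨u, hu, rfl⟩ := List.mem_map.1 h
    rw [value_invRev]
    exact inv_mem (Subgroup.subset_closure ⟨u, hu, rfl⟩)

theorem value_eq_one_of_mem_symmetrize (D : AutomaticData n) {r : GWord n}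
    (hr : r ∈ symmetrize D.relators) : D.value r = 1 := by
  have key : ∀ u ∈ D.relators, D.value u = 1 := fun u hu =>
    PresentedGroup.one_of_mem ⟨u, hu, rfl⟩
  rcases List.mem_append.1 hr with h | h
  · exact key r h
  · obtain ⟨u, hu, rfl⟩ := List.mem_map.1 h
    rw [value_invRev, key u hu, inv_one]

theorem IsDerivation.value_mem {D : AutomaticData n} {vs : List (GWord n)} {d : Derivation n}
    (hd : D.IsDerivation vs d) : D.value (derivationWord d) ∈ D.subgroupOf vs := by
  induction d with
  | nil => exact one_mem _
  | cons p d ih =>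
    have hword : derivationWord (p :: d) =
        (p.1 ++ p.2 ++ FreeGroup.invRev p.1) ++ derivationWord d := rfl
    rw [hword, value_append]
    refine mul_mem ?_ (ih fun q hq => hd q (List.mem_cons_of_mem _ hq))
    rcases hd p List.mem_cons_self with h | ⟨h1, h2⟩
    · simp [D.value_eq_one_of_mem_symmetrize h, one_mem]
    · simpa [h1] using D.value_mem_subgroupOf_of_mem_symmetrize h2

theorem Derives.value_mem {D : AutomaticData n} {vs : List (GWord n)} {C : List (Derivation n)}
    {w : GWord n} (h : D.Derives vs C w) : D.value w ∈ D.subgroupOf vs := by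
  obtain ⟨d, -, hd, hw⟩ := h
  have : D.value w = D.value (derivationWord d) :=
    congrArg (PresentedGroup.mk _) (FreeGroup.reduce.exact hw)
  rw [this]
  exact hd.value_mem

/-- The words of `π⁻¹(H)` are, up to free reduction, the products of generators of `H` and of
conjugates of relators. -/
theorem exists_isDerivation (D : AutomaticData n) {vs : List (GWord n)} {w : GWord n}
    (hw : D.value w ∈ D.subgroupOf vs) :
    ∃ d, D.IsDerivation vs d ∧ FreeGroup.reduce w = FreeGroup.reduce (derivationWord d) := by
  have single : ∀ v ∈ symmetrize vs, ∃ d, D.IsDerivation vs d ∧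
      D.value (derivationWord d) = D.value v := by
    intro v hv
    refine ⟨[([], v)], ?_, by simp [derivationWord]⟩
    intro p hp
    rw [List.mem_singleton.1 hp]
    exact Or.inr ⟨rfl, hv⟩
  have inG : ∃ d, D.IsDerivation vs d ∧ D.value (derivationWord d) = D.value w := by
    unfold subgroupOf at hw
    generalize D.value w = g at hw
    induction hw using Subgroup.closure_induction'' with
    | mem x hx =>
      obtain ⟨v, hv, rfl⟩ := hx
      exact single v (mem_symmetrize_of_mem hv)
    | inv_mem x hx =>
      obtain ⟨v, hv, rfl⟩ := hx
      rw [← value_invRev]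
      exact single _ (invRev_mem_symmetrize hv)
    | one => exact ⟨[], fun p hp => absurd hp List.not_mem_nil, rfl⟩
    | mul x y _ _ hx hy =>
      obtain ⟨d, hd, rfl⟩ := hx
      obtain ⟨e, he, rfl⟩ := hy
      exact ⟨d ++ e, hd.append he, by rw [derivationWord_append, value_append]⟩
  have conj : ∀ (r : GWord n) (c : FreeGroup (Fin n)), r ∈ symmetrize D.relators →
      ∃ d, D.IsDerivation vs d ∧
        FreeGroup.mk (derivationWord d) = c * FreeGroup.mk r * c⁻¹ := by
    intro r c hr
    refine ⟨[(c.toWord, r)], ?_, ?_⟩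
    · intro p hp
      rw [List.mem_singleton.1 hp]
      exact Or.inl hr
    · have : derivationWord [(c.toWord, r)] = c.toWord ++ r ++ FreeGroup.invRev c.toWord := by
        simp [derivationWord]
      rw [this, ← FreeGroup.mul_mk, ← FreeGroup.mul_mk, ← FreeGroup.inv_mk, FreeGroup.mk_toWord]
  have inKernel : ∀ x ∈ Subgroup.normalClosure
      {r : FreeGroup (Fin n) | ∃ w ∈ D.relators, r = FreeGroup.mk w},
      ∃ d, D.IsDerivation vs d ∧ FreeGroup.mk (derivationWord d) = x := by
    intro x hx
    unfold Subgroup.normalClosure at hx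
    induction hx using Subgroup.closure_induction'' with
    | mem x hx =>
      obtain ⟨_, ⟨r, hr, rfl⟩, hx⟩ := Group.mem_conjugatesOfSet_iff.1 hx
      obtain ⟨c, rfl⟩ := isConj_iff.1 hx
      exact conj r c (mem_symmetrize_of_mem hr)
    | inv_mem x hx =>
      obtain ⟨_, ⟨r, hr, rfl⟩, hx⟩ := Group.mem_conjugatesOfSet_iff.1 hx
      obtain ⟨c, rfl⟩ := isConj_iff.1 hx
      obtain ⟨d, hd, h⟩ := conj _ c (invRev_mem_symmetrize hr)
      refine ⟨d, hd, h.trans ?_⟩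
      rw [← FreeGroup.inv_mk]
      group
    | one => exact ⟨[], fun p hp => absurd hp List.not_mem_nil, rfl⟩
    | mul x y _ _ hx hy =>
      obtain ⟨d, hd, rfl⟩ := hx
      obtain ⟨e, he, rfl⟩ := hy
      exact ⟨d ++ e, hd.append he, by rw [derivationWord_append, FreeGroup.mul_mk]⟩
  obtain ⟨d, hd, hdw⟩ := inG
  obtain ⟨e, he, hew⟩ := inKernel (FreeGroup.mk w * (FreeGroup.mk (derivationWord d))⁻¹) (by
    rw [← PresentedGroup.mk_eq_one_iff, map_mul, map_inv, mul_inv_eq_one]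
    exact hdw.symm)
  refine ⟨e ++ d, he.append hd, FreeGroup.reduce.sound ?_⟩
  rw [derivationWord_append, ← FreeGroup.mul_mk, hew, inv_mul_cancel_right]

/-- Finitely many words of `π⁻¹(H)` have a common list of derivations. -/
theorem exists_derives (D : AutomaticData n) (vs : List (GWord n)) {W : Set (GWord n)}
    (hW : W.Finite) (h : ∀ w ∈ W, D.value w ∈ D.subgroupOf vs) :
    ∃ C, ∀ w ∈ W, D.Derives vs C w := by
  choose! d hd using fun w hw => D.exists_isDerivation (h w hw)
  refine ⟨hW.toFinset.toList.map d, fun w hw => ⟨d w, List.mem_map_of_mem ?_, hd w hw⟩⟩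
  simpa using hw

end AutomaticData

/-! ### Certificates and their soundness -/

namespace AutomaticData

variable {n : ℕ}

/-- The letters of the alphabet, in some order. -/
noncomputable def letters (n : ℕ) : List (Letter n) := Finset.univ.toList

/-- The letters of padded pairs, in some order. -/
noncomputable def pairLetters (n : ℕ) : List (Option (Letter n) × Option (Letter n)) :=
  Finset.univ.toList

theorem mem_letters (a : Letter n) : a ∈ letters n := Finset.mem_toList.2 (Finset.mem_univ a)

theorem mem_pairLetters (b : Option (Letter n) × Option (Letter n)) : b ∈ pairLetters n :=
  Finset.mem_toList.2 (Finset.mem_univ b)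

/-- For each word `s'` of `l'` there is a word `s` of `l` for which `C` shows `H s t = H s'`. -/
def Relates (D : AutomaticData n) (vs : List (GWord n)) (C : List (Derivation n))
    (l : List (GWord n)) (t : GWord n) (l' : List (GWord n)) : Prop :=
  ∀ s' ∈ l', ∃ s ∈ l, D.Derives vs C (s ++ t ++ FreeGroup.invRev s')

/-- A state of the candidate automaton, a state of the word acceptor, and a list of words which
represent the coset of `H` that the state stands for. The list is empty at states from which no
accept state can be reached, since such a state need not determine a coset. -/
abbrev LabelledState (n : ℕ) := ℕ × ℕ × List (GWord n)

/-- The list `S` is an invariant of the simultaneous run of `M` and of the word acceptor. It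
shows that every word accepted by `M` lies in `L` and represents an element of `H`. -/
def IsLabelling (D : AutomaticData n) (vs : List (GWord n)) (M : FSACode (Letter n))
    (C : List (Derivation n)) (S : List (LabelledState n)) : Prop :=
  (∃ x ∈ S, x.1 = 0 ∧ x.2.1 = 0 ∧ D.Relates vs C [[]] [] x.2.2) ∧
  (∀ x ∈ S, ∀ a ∈ letters n, ∃ y ∈ S,
    y.1 = M.next x.1 a ∧ y.2.1 = D.wordAcceptor.next x.2.1 a ∧
      D.Relates vs C x.2.2 [a] y.2.2) ∧
  (∀ x ∈ S, x.1 ∈ M.accepting →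
    x.2.1 ∈ D.wordAcceptor.accepting ∧ D.Relates vs C x.2.2 [] [[]])

/-- An edge `(P, a, Q, I)` claims that right multiplication by the letter `a` maps the words
of `L` accepted by `P` to words accepted by `Q`. The list `I` of triples of states of `P`, of the
comparison automaton of `a` and of `Q` is evidence for the claim. -/
abbrev Edge (n : ℕ) :=
  FSACode (Letter n) × Letter n × FSACode (Letter n) × List (ℕ × ℕ × ℕ)

/-- The triples of an edge are an invariant of the simultaneous run on padded pairs, and no
triple violates the claim. -/
def IsEdge (D : AutomaticData n) (e : Edge n) : Prop :=
  (0, 0, 0) ∈ e.2.2.2 ∧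
  (∀ s ∈ e.2.2.2, ∀ b ∈ pairLetters n,
    (e.1.tapeNext s.1 b.1, (D.letterAut e.2.1).next s.2.1 b,
      e.2.2.1.tapeNext s.2.2 b.2) ∈ e.2.2.2) ∧
  (∀ s ∈ e.2.2.2, s.1 ∈ e.1.accepting → s.2.1 ∈ (D.letterAut e.2.1).accepting →
    s.2.2 ∈ e.2.2.1.accepting)

/-- The sources of the edges with letter `a` and target in `S`. -/
noncomputable def sources (E : List (Edge n)) (a : Letter n) (S : List (FSACode (Letter n))) :
    List (FSACode (Letter n)) :=
  open Classical in E.filterMap fun e => if e.2.1 = a ∧ e.2.2.1 ∈ S then some e.1 else none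

/-- The automata from which a path of edges labelled by the word `v` leads to `M`. -/
noncomputable def pathSources (E : List (Edge n)) (M : FSACode (Letter n)) (v : GWord n) :
    List (FSACode (Letter n)) :=
  v.foldr (sources E) [M]

/-- A list of derivations, a labelling, an accepted word and a list of edges. -/
abbrev Certificate (n : ℕ) :=
  List (Derivation n) × List (LabelledState n) × GWord n × List (Edge n)

/-- The certificate shows that `M` recognizes the language `L_H`. -/
def Certifies (D : AutomaticData n) (vs : List (GWord n)) (M : FSACode (Letter n))
    (c : Certificate n) : Prop :=
  D.IsLabelling vs M c.1 c.2.1 ∧ M.run c.2.2.1 ∈ M.accepting ∧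
  (∀ e ∈ c.2.2.2, D.IsEdge e) ∧
  (∀ v ∈ symmetrize vs, M ∈ pathSources c.2.2.2 M v)

theorem mem_sources {E : List (Edge n)} {a : Letter n} {S : List (FSACode (Letter n))}
    {P : FSACode (Letter n)} :
    P ∈ sources E a S ↔ ∃ e ∈ E, e.2.1 = a ∧ e.2.2.1 ∈ S ∧ e.1 = P := by
  simp only [sources, List.mem_filterMap]
  refine exists_congr fun e => and_congr_right fun _ => ?_
  split_ifs with h
  · simp [h]
  · simp only [false_iff]
    exact fun h' => h ⟨h'.1, h'.2.1⟩

theorem Relates.mem {D : AutomaticData n} {vs : List (GWord n)} {C : List (Derivation n)}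
    {l l' : List (GWord n)} {t : GWord n} (h : D.Relates vs C l t l') {s' : GWord n}
    (hs' : s' ∈ l') :
    ∃ s ∈ l, D.value s * D.value t * (D.value s')⁻¹ ∈ D.subgroupOf vs := by
  obtain ⟨s, hs, hd⟩ := h s' hs'
  exact ⟨s, hs, by simpa [mul_assoc] using hd.value_mem⟩

theorem IsLabelling.language_le {D : AutomaticData n} {vs : List (GWord n)}
    {M : FSACode (Letter n)} {C : List (Derivation n)} {S : List (LabelledState n)}
    (h : D.IsLabelling vs M C S) {w : GWord n} (hw : w ∈ M.language) :
    w ∈ D.lang ∧ D.value w ∈ D.subgroupOf vs := by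
  obtain ⟨⟨x₀, hx₀, h1, h2, h3⟩, hstep, hacc⟩ := h
  have key : ∀ w : GWord n, ∃ x ∈ S, x.1 = M.run w ∧ x.2.1 = D.wordAcceptor.run w ∧
      ∀ s ∈ x.2.2, D.value w * (D.value s)⁻¹ ∈ D.subgroupOf vs := by
    intro w
    induction w using List.reverseRecOn with
    | nil =>
      refine ⟨x₀, hx₀, h1, h2, fun s hs => ?_⟩
      obtain ⟨t, ht, hmem⟩ := h3.mem hs
      rw [List.mem_singleton.1 ht] at hmem
      simpa using hmem
    | append_singleton w a ih =>
      obtain ⟨x, hx, hM, hL, hs⟩ := ih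
      obtain ⟨y, hy, hM', hL', hrel⟩ := hstep x hx a (mem_letters a)
      refine ⟨y, hy, by rw [hM', hM, FSACode.run_append_singleton],
        by rw [hL', hL, FSACode.run_append_singleton], fun s' hs' => ?_⟩
      obtain ⟨s, hsx, hmem⟩ := hrel.mem hs'
      have := mul_mem (hs s hsx) hmem
      rw [value_append]
      simpa [mul_assoc] using this
  obtain ⟨x, hx, hM, hL, hs⟩ := key w
  obtain ⟨hxL, hrel⟩ := hacc x hx (hM ▸ (M.mem_language w).1 hw)
  refine ⟨(D.wordAcceptor.mem_language w).2 (hL ▸ hxL), ?_⟩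
  obtain ⟨s, hsx, hmem⟩ := hrel.mem (List.mem_singleton_self _)
  have := mul_mem (hs s hsx) hmem
  simpa using this

/-- The triple of states reached on a padded pair consists of the states reached by `P` on the first
word, by the comparison automaton on the pair and by `Q` on the second word. -/
theorem IsEdge.mem_language {D : AutomaticData n} {e : Edge n} (h : D.IsEdge e)
    {w u : GWord n} (hw : w ∈ e.1.language) (hwu : padPair w u ∈ (D.letterAut e.2.1).language) :
    u ∈ e.2.2.1.language := by
  obtain ⟨h0, hstep, hacc⟩ := h
  have key : ∀ x : List (Option (Letter n) × Option (Letter n)),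
      (e.1.run (x.filterMap Prod.fst), (D.letterAut e.2.1).run x,
        e.2.2.1.run (x.filterMap Prod.snd)) ∈ e.2.2.2 := by
    intro x
    induction x using List.reverseRecOn with
    | nil => exact h0
    | append_singleton x b ih =>
      rw [FSACode.run_tape_append_singleton, FSACode.run_tape_append_singleton,
        FSACode.run_append_singleton]
      exact hstep _ ih b (mem_pairLetters b)
  have := key (padPair w u)
  rw [filterMap_fst_padPair, filterMap_snd_padPair] at this
  rw [FSACode.mem_language] at hw hwu ⊢
  exact hacc _ this hw hwu

/-- The language `K` is invariant under right multiplication by `g`, when elements are replaced by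
their representatives in `L`. -/
def IsClosedUnder (D : AutomaticData n) (K : Language (Letter n)) (g : D.Grp) : Prop :=
  ∀ w ∈ K, w ∈ D.lang → ∀ u ∈ D.lang, D.value w * g = D.value u → u ∈ K

/-- Multiplication by `v` is followed letter by letter along a path of edges; the path ends at `M`,
and the representative in `L` of the final element is unique. -/
theorem isClosedUnder_of_mem_pathSources {D : AutomaticData n}
    (hD : D.IsAutomaticWithUniqueness) {E : List (Edge n)} (hE : ∀ e ∈ E, D.IsEdge e)
    {M : FSACode (Letter n)} {v : GWord n} (hv : M ∈ pathSources E M v) :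
    D.IsClosedUnder M.language (D.value v) := by
  suffices ∀ (v : GWord n), ∀ P ∈ pathSources E M v, ∀ w ∈ P.language, w ∈ D.lang →
      ∀ u ∈ D.lang, D.value w * D.value v = D.value u → u ∈ M.language from this v M hv
  intro v
  induction v with
  | nil =>
    intro P hP w hw hwL u hu h
    rw [List.mem_singleton.1 hP] at hw
    rw [value_nil, mul_one] at h
    rwa [(hD.existsUnique (D.value u)).unique ⟨hu, rfl⟩ ⟨hwL, h⟩]
  | cons a v ih =>
    intro P hP w hw hwL u hu h
    obtain ⟨e, he, rfl, hQ, rfl⟩ := mem_sources.1 hP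
    obtain ⟨u', ⟨hu', hval⟩, -⟩ := hD.existsUnique (D.value (w ++ [e.2.1]))
    have hpair : padPair w u' ∈ (D.letterAut e.2.1).language := by
      rw [hD.multiplier]
      exact ⟨w, hwL, u', hu', hval.symm, rfl⟩
    refine ih _ hQ u' ((hE e he).mem_language hw hpair) hu' u hu ?_
    rw [hval, ← h, ← value_append, ← value_append, List.append_assoc]
    rfl

theorem isClosedUnder_of_mem_subgroupOf {D : AutomaticData n}
    (hD : D.IsAutomaticWithUniqueness) {vs : List (GWord n)} {K : Language (Letter n)}
    (hK : ∀ v ∈ symmetrize vs, D.IsClosedUnder K (D.value v)) {g : D.Grp}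
    (hg : g ∈ D.subgroupOf vs) : D.IsClosedUnder K g := by
  unfold subgroupOf at hg
  induction hg using Subgroup.closure_induction'' with
  | mem x hx =>
    obtain ⟨v, hv, rfl⟩ := hx
    exact hK v (mem_symmetrize_of_mem hv)
  | inv_mem x hx =>
    obtain ⟨v, hv, rfl⟩ := hx
    rw [← value_invRev]
    exact hK _ (invRev_mem_symmetrize hv)
  | one =>
    intro w hw hwL u hu h
    rw [mul_one] at h
    rwa [(hD.existsUnique (D.value u)).unique ⟨hu, rfl⟩ ⟨hwL, h⟩]
  | mul x y _ _ hx hy =>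
    intro w hw hwL u hu h
    obtain ⟨u', ⟨hu', hval⟩, -⟩ := hD.existsUnique (D.value w * x)
    refine hy u' (hx w hw hwL u' hu' hval.symm) hu' u hu ?_
    rw [hval, ← h, mul_assoc]

theorem Certifies.language_eq {D : AutomaticData n} (hD : D.IsAutomaticWithUniqueness)
    {vs : List (GWord n)} {M : FSACode (Letter n)} {c : Certificate n}
    (h : D.Certifies vs M c) : M.language = D.preimageLang (D.subgroupOf vs) := by
  obtain ⟨hlab, hw₀, hE, hpath⟩ := h
  apply le_antisymm
  · exact fun w hw => hlab.language_le hw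
  · rintro u ⟨hu, huH⟩
    have hw₀ := (M.mem_language _).2 hw₀
    obtain ⟨hwL, hwH⟩ := hlab.language_le hw₀
    -- the words of `L_H` are all reached from one accepted word by multiplications by `H`
    refine isClosedUnder_of_mem_subgroupOf hD
      (fun v hv => isClosedUnder_of_mem_pathSources hD hE (hpath v hv))
      (mul_mem (inv_mem hwH) huH) _ hw₀ hwL u hu ?_
    rw [mul_inv_cancel_left]

end AutomaticData

/-! ### Existence of certificates -/

namespace AutomaticData

variable {n : ℕ}

/-- The labelled states are those reached by words; a state from which an accept state can be
reached is labelled by one word that leads to it. -/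
theorem exists_isLabelling (D : AutomaticData n) {vs : List (GWord n)} {M : FSACode (Letter n)}
    (hM : M.language = D.preimageLang (D.subgroupOf vs)) :
    ∃ C S, D.IsLabelling vs M C S := by
  classical
  have mem_iff : ∀ w : GWord n, M.run w ∈ M.accepting ↔
      w ∈ D.lang ∧ D.value w ∈ D.subgroupOf vs := by
    intro w
    rw [← M.mem_language, hM]
    rfl
  -- words which lead to the same live state represent the same coset
  have coset : ∀ u u' t : GWord n, M.run u = M.run u' → M.run (u' ++ t) ∈ M.accepting →
      D.value u * (D.value u')⁻¹ ∈ D.subgroupOf vs := by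
    intro u u' t h ht
    have hu := ((mem_iff _).1 (M.run_append_congr h t ▸ ht : M.run (u ++ t) ∈ M.accepting)).2
    have hu' := ((mem_iff _).1 ht).2
    have := mul_mem hu (inv_mem hu')
    rw [value_append, value_append] at this
    simpa [mul_assoc] using this
  let Live : ℕ → GWord n → Prop := fun q s => M.run s = q ∧ ∃ t, M.run (s ++ t) ∈ M.accepting
  let label : ℕ → List (GWord n) := fun q => if h : ∃ s, Live q s then [h.choose] else []
  have label_spec : ∀ {q s}, s ∈ label q → Live q s := by
    intro q s hs
    by_cases h : ∃ s, Live q s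
    · simp only [label, dif_pos h, List.mem_singleton] at hs
      exact hs ▸ h.choose_spec
    · simp only [label, dif_neg h, List.not_mem_nil] at hs
  have label_ex : ∀ {q s}, Live q s → ∃ s', s' ∈ label q := by
    intro q s hs
    have h : ∃ s, Live q s := ⟨s, hs⟩
    exact ⟨h.choose, by simp only [label, dif_pos h, List.mem_singleton]⟩
  let A : Set (GWord n) := {[]} ∪ {s | ∃ q < M.lastState + 1, s ∈ label q}
  have hA : A.Finite := by
    refine (Set.finite_singleton _).union (((Set.finite_Iio (M.lastState + 1)).biUnion
      fun q _ => List.finite_toSet (label q)).subset ?_)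
    rintro s ⟨q, hq, hs⟩
    exact Set.mem_biUnion (Set.mem_Iio.2 hq) hs
  have hT : {t : GWord n | t.length ≤ 1}.Finite := List.finite_length_le _ 1
  obtain ⟨C, hC⟩ := D.exists_derives vs
    (W := (fun p : GWord n × GWord n × GWord n => p.1 ++ p.2.1 ++ FreeGroup.invRev p.2.2) ''
      (A ×ˢ {t : GWord n | t.length ≤ 1} ×ˢ A) ∩ {w | D.value w ∈ D.subgroupOf vs})
    (((hA.prod (hT.prod hA)).image _).subset Set.inter_subset_left) (fun w hw => hw.2)
  have derives : ∀ s ∈ A, ∀ t : GWord n, t.length ≤ 1 → ∀ s' ∈ A,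
      D.value (s ++ t) * (D.value s')⁻¹ ∈ D.subgroupOf vs →
      D.Derives vs C (s ++ t ++ FreeGroup.invRev s') := by
    intro s hs t ht s' hs' h
    refine hC _ ⟨⟨(s, t, s'), ⟨hs, ht, hs'⟩, rfl⟩, ?_⟩
    change D.value (s ++ t ++ FreeGroup.invRev s') ∈ D.subgroupOf vs
    rwa [value_append, value_invRev]
  have nil_mem : ([] : GWord n) ∈ A := Or.inl rfl
  have label_mem : ∀ {w s : GWord n}, s ∈ label (M.run w) → s ∈ A :=
    fun {w s} hs => Or.inr ⟨_, M.run_lt w, hs⟩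
  let state : GWord n → LabelledState n :=
    fun w => (M.run w, D.wordAcceptor.run w, label (M.run w))
  have hfin : (Set.range state).Finite := by
    refine (((Set.finite_Iio (M.lastState + 1)).prod
      (Set.finite_Iio (D.wordAcceptor.lastState + 1))).image
        (fun p : ℕ × ℕ => ((p.1, p.2, label p.1) : LabelledState n))).subset ?_
    rintro _ ⟨w, rfl⟩
    exact ⟨(M.run w, D.wordAcceptor.run w), ⟨M.run_lt w, D.wordAcceptor.run_lt w⟩, rfl⟩
  have mem_S : ∀ x, x ∈ hfin.toFinset.toList ↔ ∃ w, state w = x := by simp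
  refine ⟨C, hfin.toFinset.toList, ⟨state [], (mem_S _).2 ⟨[], rfl⟩, rfl, rfl, ?_⟩, ?_, ?_⟩
  · intro s' hs'
    obtain ⟨hrun, t, ht⟩ := label_spec hs'
    exact ⟨[], List.mem_singleton_self _, derives _ nil_mem _ (by simp) _ (label_mem hs')
      (coset _ _ t hrun.symm ht)⟩
  · intro x hx a _
    obtain ⟨w, rfl⟩ := (mem_S x).1 hx
    refine ⟨state (w ++ [a]), (mem_S _).2 ⟨_, rfl⟩, M.run_append_singleton w a,
      D.wordAcceptor.run_append_singleton w a, ?_⟩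
    intro s' hs'
    obtain ⟨hrun, t, ht⟩ := label_spec hs'
    have hlive : Live (M.run w) w := by
      refine ⟨rfl, [a] ++ t, ?_⟩
      rw [← List.append_assoc, ← M.run_append_congr hrun t]
      exact ht
    obtain ⟨s, hs⟩ := label_ex hlive
    exact ⟨s, hs, derives _ (label_mem hs) _ (by simp) _ (label_mem hs')
      (coset _ _ t ((M.run_append_congr (label_spec hs).1 [a]).trans hrun.symm) ht)⟩
  · intro x hx hacc
    obtain ⟨w, rfl⟩ := (mem_S x).1 hx
    refine ⟨(D.wordAcceptor.mem_language w).1 ((mem_iff w).1 hacc).1, ?_⟩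
    intro s' hs'
    rw [List.mem_singleton.1 hs']
    obtain ⟨s, hs⟩ := label_ex (show Live (M.run w) w from ⟨rfl, [], by simpa using hacc⟩)
    have hsH := ((mem_iff s).1 ((label_spec hs).1 ▸ hacc : M.run s ∈ M.accepting)).2
    exact ⟨s, hs, derives _ (label_mem hs) _ (by simp) _ nil_mem (by simpa using hsH)⟩

/-- All reachable triples form an invariant. The comparison automaton accepts nothing but padded
pairs, so words over pairs of letters that are not padded pairs do no harm. -/
theorem exists_isEdge {D : AutomaticData n} (hD : D.IsAutomaticWithUniqueness)
    {P Q : FSACode (Letter n)} {a : Letter n}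
    (h : ∀ w ∈ P.language, w ∈ D.lang → ∀ u ∈ D.lang,
      D.value w * D.value [a] = D.value u → u ∈ Q.language) :
    ∃ I, D.IsEdge (P, a, Q, I) := by
  let state : List (Option (Letter n) × Option (Letter n)) → ℕ × ℕ × ℕ := fun x =>
    (P.run (x.filterMap Prod.fst), (D.letterAut a).run x, Q.run (x.filterMap Prod.snd))
  have hfin : (Set.range state).Finite := by
    refine ((Set.finite_Iio (P.lastState + 1)).prod
      ((Set.finite_Iio ((D.letterAut a).lastState + 1)).prod
        (Set.finite_Iio (Q.lastState + 1)))).subset ?_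
    rintro _ ⟨x, rfl⟩
    exact ⟨P.run_lt _, (D.letterAut a).run_lt _, Q.run_lt _⟩
  have mem_I : ∀ s, s ∈ hfin.toFinset.toList ↔ ∃ x, state x = s := by simp
  refine ⟨hfin.toFinset.toList, (mem_I _).2 ⟨[], rfl⟩, ?_, ?_⟩
  · intro s hs b _
    obtain ⟨x, rfl⟩ := (mem_I s).1 hs
    refine (mem_I _).2 ⟨x ++ [b], ?_⟩
    simp only [state, FSACode.run_tape_append_singleton, FSACode.run_append_singleton]
  · intro s hs hP hacc
    obtain ⟨x, rfl⟩ := (mem_I s).1 hs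
    have hx := ((D.letterAut a).mem_language x).2 hacc
    rw [hD.multiplier] at hx
    obtain ⟨w, hw, u, hu, hval, rfl⟩ := hx
    simp only [state, filterMap_fst_padPair, filterMap_snd_padPair] at hP ⊢
    rw [value_append] at hval
    exact (Q.mem_language u).1 (h w ((P.mem_language w).2 hP) hw u hu hval)

/-- The words of `L` which represent elements of the coset `H g`. -/
def cosetLang (D : AutomaticData n) (H : Subgroup D.Grp) (g : D.Grp) : Language (Letter n) :=
  {w | w ∈ D.lang ∧ D.value w * g⁻¹ ∈ H}

theorem mem_cosetLang {D : AutomaticData n} {H : Subgroup D.Grp} {g : D.Grp} {w : GWord n} :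
    w ∈ D.cosetLang H g ↔ w ∈ D.lang ∧ D.value w * g⁻¹ ∈ H := Iff.rfl

theorem cosetLang_of_mem {D : AutomaticData n} {H : Subgroup D.Grp} {g : D.Grp} (hg : g ∈ H) :
    D.cosetLang H g = D.preimageLang H := by
  ext w
  exact and_congr_right fun _ => H.mul_mem_cancel_right (inv_mem hg)

/-- If one coset of `H` has a regular language of representatives, then so do all others, as
the comparison automata turn one into another. -/
theorem isRegular_cosetLang {D : AutomaticData n} (hD : D.IsAutomaticWithUniqueness)
    {H : Subgroup D.Grp} (hH : D.IsRational H) (v : GWord n) :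
    (D.cosetLang H (D.value v)).IsRegular := by
  induction v using List.reverseRecOn with
  | nil =>
    rw [value_nil, cosetLang_of_mem (one_mem H)]
    exact hH
  | append_singleton v a ih =>
    refine ih.image_tapes (D.letterAut a).isRegular_language Prod.fst Prod.snd fun u => ?_
    rw [hD.multiplier, mem_cosetLang, value_append]
    constructor
    · rintro ⟨hu, huH⟩
      obtain ⟨w, ⟨hw, hval⟩, -⟩ := hD.existsUnique (D.value u * (D.value [a])⁻¹)
      refine ⟨padPair w u, ⟨w, hw, u, hu, ?_, rfl⟩, ?_, filterMap_snd_padPair w u⟩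
      · rw [value_append, hval, inv_mul_cancel_right]
      · rw [filterMap_fst_padPair, mem_cosetLang]
        refine ⟨hw, ?_⟩
        rw [hval]
        simpa [mul_assoc] using huH
    · rintro ⟨_, ⟨w, hw, u', hu', hval, rfl⟩, hwH, hu⟩
      rw [filterMap_snd_padPair] at hu
      subst hu
      rw [filterMap_fst_padPair, mem_cosetLang] at hwH
      refine ⟨hu', ?_⟩
      rw [← hval, value_append]
      simpa [mul_assoc] using hwH.2

theorem exists_certifies {D : AutomaticData n} (hD : D.IsAutomaticWithUniqueness)
    {vs : List (GWord n)} (hH : D.IsRational (D.subgroupOf vs)) :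
    ∃ M c, D.Certifies vs M c := by
  have hcode : ∀ K : Language (Letter n), ∃ M : FSACode (Letter n),
      K.IsRegular → M.language = K := by
    intro K
    by_cases hK : K.IsRegular
    · obtain ⟨M, hM⟩ := FSACode.exists_language_eq hK
      exact ⟨M, fun _ => hM⟩
    · exact ⟨⟨0, [], []⟩, fun h => absurd h hK⟩
  -- the code depends only on the language, so a word of `π⁻¹(H)` gets the same code as the
  -- empty word
  choose code code_spec using hcode
  let M : GWord n → FSACode (Letter n) :=
    fun v => code (D.cosetLang (D.subgroupOf vs) (D.value v))
  have hM : ∀ v, (M v).language = D.cosetLang (D.subgroupOf vs) (D.value v) :=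
    fun v => code_spec _ (isRegular_cosetLang hD hH v)
  have hM₀ : (M []).language = D.preimageLang (D.subgroupOf vs) := by
    rw [hM, value_nil, cosetLang_of_mem (one_mem _)]
  have hedge : ∀ (p : GWord n) (a : Letter n), ∃ I, D.IsEdge (M p, a, M (p ++ [a]), I) := by
    intro p a
    refine exists_isEdge hD fun w hw _ u hu hval => ?_
    rw [hM] at hw ⊢
    rw [mem_cosetLang] at hw ⊢
    refine ⟨hu, ?_⟩
    rw [← hval, value_append]
    simpa [mul_assoc] using hw.2
  choose I hI using hedge
  let E : List (Edge n) := (symmetrize vs).flatMap fun v => v.inits.flatMap fun p =>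
    (letters n).map fun a => (M p, a, M (p ++ [a]), I p a)
  have hE : ∀ e ∈ E, D.IsEdge e := by
    intro e he
    obtain ⟨v, -, he⟩ := List.mem_flatMap.1 he
    obtain ⟨p, -, he⟩ := List.mem_flatMap.1 he
    obtain ⟨a, -, rfl⟩ := List.mem_map.1 he
    exact hI p a
  have hpath : ∀ v ∈ symmetrize vs, M [] ∈ pathSources E (M []) v := by
    intro v hv
    have hend : M v = M [] := by
      simp only [M, value_nil, cosetLang_of_mem (one_mem (D.subgroupOf vs)),
        cosetLang_of_mem (D.value_mem_subgroupOf_of_mem_symmetrize hv)]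
    suffices ∀ s p : GWord n, p ++ s = v → M p ∈ pathSources E (M []) s from this v [] rfl
    intro s
    induction s with
    | nil =>
      intro p hp
      rw [List.append_nil] at hp
      rw [hp, hend]
      exact List.mem_singleton_self _
    | cons a s ih =>
      intro p hp
      refine mem_sources.2 ⟨(M p, a, M (p ++ [a]), I p a), ?_, rfl, ih (p ++ [a]) (by simpa), rfl⟩
      exact List.mem_flatMap.2 ⟨v, hv, List.mem_flatMap.2
        ⟨p, (List.mem_inits _ _).2 ⟨_, hp⟩, List.mem_map.2 ⟨a, mem_letters a, rfl⟩⟩⟩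
  obtain ⟨C, S, hCS⟩ := D.exists_isLabelling hM₀
  obtain ⟨w₀, ⟨hw₀, hval⟩, -⟩ := hD.existsUnique 1
  refine ⟨M [], (C, S, w₀, E), hCS, ?_, hE, hpath⟩
  rw [← FSACode.mem_language, hM₀]
  refine ⟨hw₀, ?_⟩
  rw [hval]
  exact one_mem _

end AutomaticData

/-! ### Primitive recursiveness of the certificate check -/

section PrimrecAux

variable {γ β : Type*} [Primcodable γ] [Primcodable β]

theorem PrimrecPred.forall_mem {f : γ → List β} {p : γ → β → Prop} (hf : Primrec f)
    (hp : PrimrecPred fun z : γ × β => p z.1 z.2) : PrimrecPred fun x => ∀ b ∈ f x, p x b := by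
  have hR : PrimrecRel fun (b : β) (x : γ) => p x b :=
    PrimrecPred.comp hp (Primrec.pair Primrec.snd Primrec.fst)
  exact hR.forall_mem_list.comp hf Primrec.id

theorem PrimrecPred.exists_mem {f : γ → List β} {p : γ → β → Prop} (hf : Primrec f)
    (hp : PrimrecPred fun z : γ × β => p z.1 z.2) : PrimrecPred fun x => ∃ b ∈ f x, p x b := by
  have hR : PrimrecRel fun (b : β) (x : γ) => p x b :=
    PrimrecPred.comp hp (Primrec.pair Primrec.snd Primrec.fst)
  exact hR.exists_mem_list.comp hf Primrec.id

theorem PrimrecPred.eq {f g : γ → β} (hf : Primrec f) (hg : Primrec g) :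
    PrimrecPred fun x => f x = g x := by
  classical
  exact PrimrecRel.comp Primrec.eq hf hg

theorem PrimrecPred.mem {f : γ → β} {l : γ → List β} (hf : Primrec f) (hl : Primrec l) :
    PrimrecPred fun x => f x ∈ l x :=
  (PrimrecPred.exists_mem (p := fun x b => b = f x) hl
    (PrimrecPred.eq Primrec.snd (hf.comp Primrec.fst))).of_eq fun x => by simp

end PrimrecAux

namespace FSACode

variable {γ α : Type} [Primcodable γ] [Primcodable α]

theorem primrec_accepting : Primrec (accepting : FSACode α → List ℕ) :=
  Primrec.snd.comp (Primrec.snd.comp (Primrec.of_equiv (e := equivProd α)))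

variable [DecidableEq α]

theorem primrec_next {M : γ → FSACode α} {q : γ → ℕ} {a : γ → α} (hM : Primrec M)
    (hq : Primrec q) (ha : Primrec a) : Primrec fun x => (M x).next (q x) (a x) := by
  have hparts : Primrec fun x => equivProd α (M x) := Primrec.of_equiv.comp hM
  refine Primrec.nat_mod.comp (Primrec.option_getD.comp ?_ (Primrec.const 0))
    (Primrec.succ.comp (Primrec.fst.comp hparts))
  -- the boolean equality of pairs in `next` is not syntactically the one in `Primrec.listLookup`
  rw [lawful_beq_subsingleton (instBEqProd : BEq (ℕ × α)) instBEqOfDecidableEq]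
  exact Primrec.listLookup.comp (Primrec.pair hq ha) (Primrec.fst.comp (Primrec.snd.comp hparts))

theorem primrec_run {M : γ → FSACode α} {w : γ → List α} (hM : Primrec M) (hw : Primrec w) :
    Primrec fun x => (M x).run (w x) :=
  Primrec.list_foldl hw (Primrec.const 0)
    (primrec_next (hM.comp Primrec.fst) (Primrec.fst.comp Primrec.snd)
      (Primrec.snd.comp Primrec.snd)).to₂

theorem primrec_tapeNext {M : γ → FSACode α} {q : γ → ℕ} {a : γ → Option α} (hM : Primrec M)
    (hq : Primrec q) (ha : Primrec a) : Primrec fun x => (M x).tapeNext (q x) (a x) :=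
  (Primrec.option_casesOn ha hq
    (primrec_next (hM.comp Primrec.fst) (hq.comp Primrec.fst) Primrec.snd).to₂).of_eq
    fun x => by cases a x <;> rfl

end FSACode

namespace AutomaticData

variable {n : ℕ} {γ : Type} [Primcodable γ]

theorem primrec_relators : Primrec (relators : AutomaticData n → List (GWord n)) :=
  Primrec.fst.comp (Primrec.of_equiv (e := equivProd n))

theorem primrec_wordAcceptor : Primrec (wordAcceptor : AutomaticData n → FSACode (Letter n)) :=
  Primrec.fst.comp (Primrec.snd.comp (Primrec.of_equiv (e := equivProd n)))

theorem primrec_letterAut {D : γ → AutomaticData n} {a : γ → Letter n} (hD : Primrec D)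
    (ha : Primrec a) : Primrec fun x => (D x).letterAut (a x) := by
  have hparts : Primrec fun x => (equivProd n (D x)).2.2.2 :=
    Primrec.snd.comp (Primrec.snd.comp (Primrec.snd.comp (Primrec.of_equiv.comp hD)))
  have hi : Primrec fun x => (a x).1 := Primrec.fst.comp ha
  refine (Primrec.cond (Primrec.snd.comp ha) (Primrec.fin_app.comp (Primrec.fst.comp hparts) hi)
    (Primrec.fin_app.comp (Primrec.snd.comp hparts) hi)).of_eq fun x => ?_
  rcases a x with ⟨i, _ | _⟩ <;> rfl

theorem primrec_invRev : Primrec (FreeGroup.invRev : GWord n → GWord n) :=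
  Primrec.list_reverse.comp (Primrec.list_map Primrec.id
    (Primrec.pair (Primrec.fst.comp Primrec.snd)
      (Primrec.not.comp (Primrec.snd.comp Primrec.snd))).to₂)

theorem primrec_reduce : Primrec (FreeGroup.reduce : GWord n → GWord n) := by
  refine (Primrec.list_foldr (f := fun w : GWord n => w) (g := fun _ => ([] : GWord n))
    (h := fun _ p => List.casesOn p.2 [p.1] fun b t =>
      if p.1.1 = b.1 ∧ p.1.2 = !b.2 then t else p.1 :: b :: t)
    Primrec.id (Primrec.const []) ?_).of_eq fun w => ?_
  · have ha : Primrec fun z : (GWord n × (Letter n × GWord n)) × (Letter n × GWord n) =>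
        z.1.2.1 := Primrec.fst.comp (Primrec.snd.comp Primrec.fst)
    have hb : Primrec fun z : (GWord n × (Letter n × GWord n)) × (Letter n × GWord n) =>
        z.2.1 := Primrec.fst.comp Primrec.snd
    have ht : Primrec fun z : (GWord n × (Letter n × GWord n)) × (Letter n × GWord n) =>
        z.2.2 := Primrec.snd.comp Primrec.snd
    have hcond := (PrimrecPred.eq (Primrec.fst.comp ha) (Primrec.fst.comp hb)).and
      (PrimrecPred.eq (Primrec.snd.comp ha) (Primrec.not.comp (Primrec.snd.comp hb)))
    exact Primrec.list_casesOn (Primrec.snd.comp Primrec.snd)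
      (Primrec.list_cons.comp (Primrec.fst.comp Primrec.snd) (Primrec.const []))
      (Primrec.ite hcond ht (Primrec.list_cons.comp ha (Primrec.list_cons.comp hb ht))).to₂
  · induction w with
    | nil => rfl
    | cons a w ih =>
      rw [List.foldr_cons, ih]
      rfl

theorem primrec_symmetrize : Primrec (symmetrize : List (GWord n) → List (GWord n)) :=
  Primrec.list_append.comp Primrec.id
    (Primrec.list_map Primrec.id (primrec_invRev.comp Primrec.snd).to₂)

theorem primrec_derivationWord : Primrec (derivationWord : Derivation n → GWord n) := by
  have h1 : Primrec fun z : Derivation n × (GWord n × GWord n) => z.2.1 :=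
    Primrec.fst.comp Primrec.snd
  have h2 : Primrec fun z : Derivation n × (GWord n × GWord n) => z.2.2 :=
    Primrec.snd.comp Primrec.snd
  exact Primrec.list_flatMap Primrec.id
    (Primrec.list_append.comp (Primrec.list_append.comp h1 h2) (primrec_invRev.comp h1)).to₂

theorem primrecPred_isDerivation {D : γ → AutomaticData n} {vs : γ → List (GWord n)}
    {d : γ → Derivation n} (hD : Primrec D) (hvs : Primrec vs) (hd : Primrec d) :
    PrimrecPred fun x => (D x).IsDerivation (vs x) (d x) := by
  refine PrimrecPred.forall_mem hd (PrimrecPred.or ?_ (PrimrecPred.and ?_ ?_))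
  · exact PrimrecPred.mem (Primrec.snd.comp Primrec.snd)
      (primrec_symmetrize.comp (primrec_relators.comp (hD.comp Primrec.fst)))
  · exact PrimrecPred.eq (Primrec.fst.comp Primrec.snd) (Primrec.const [])
  · exact PrimrecPred.mem (Primrec.snd.comp Primrec.snd)
      (primrec_symmetrize.comp (hvs.comp Primrec.fst))

theorem primrecPred_derives {D : γ → AutomaticData n} {vs : γ → List (GWord n)}
    {C : γ → List (Derivation n)} {w : γ → GWord n} (hD : Primrec D) (hvs : Primrec vs)
    (hC : Primrec C) (hw : Primrec w) :
    PrimrecPred fun x => (D x).Derives (vs x) (C x) (w x) :=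
  PrimrecPred.exists_mem hC
    ((primrecPred_isDerivation (hD.comp Primrec.fst) (hvs.comp Primrec.fst) Primrec.snd).and
      (PrimrecPred.eq (primrec_reduce.comp (hw.comp Primrec.fst))
        (primrec_reduce.comp (primrec_derivationWord.comp Primrec.snd))))

theorem primrecPred_relates {D : γ → AutomaticData n} {vs : γ → List (GWord n)}
    {C : γ → List (Derivation n)} {l l' : γ → List (GWord n)} {t : γ → GWord n}
    (hD : Primrec D) (hvs : Primrec vs) (hC : Primrec C) (hl : Primrec l) (ht : Primrec t)
    (hl' : Primrec l') : PrimrecPred fun x => (D x).Relates (vs x) (C x) (l x) (t x) (l' x) := by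
  have hx : Primrec fun z : (γ × GWord n) × GWord n => z.1.1 := Primrec.fst.comp Primrec.fst
  exact PrimrecPred.forall_mem hl' (PrimrecPred.exists_mem (hl.comp Primrec.fst)
    (primrecPred_derives (hD.comp hx) (hvs.comp hx) (hC.comp hx)
      (Primrec.list_append.comp (Primrec.list_append.comp Primrec.snd (ht.comp hx))
        (primrec_invRev.comp (Primrec.snd.comp Primrec.fst)))))

theorem primrecPred_isLabelling {D : γ → AutomaticData n} {vs : γ → List (GWord n)}
    {M : γ → FSACode (Letter n)} {C : γ → List (Derivation n)} {S : γ → List (LabelledState n)}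
    (hD : Primrec D) (hvs : Primrec vs) (hM : Primrec M) (hC : Primrec C) (hS : Primrec S) :
    PrimrecPred fun x => (D x).IsLabelling (vs x) (M x) (C x) (S x) := by
  have h1 : Primrec fun z : LabelledState n => z.1 := Primrec.fst
  have h2 : Primrec fun z : LabelledState n => z.2.1 := Primrec.fst.comp Primrec.snd
  have h3 : Primrec fun z : LabelledState n => z.2.2 := Primrec.snd.comp Primrec.snd
  refine PrimrecPred.and ?_ (PrimrecPred.and ?_ ?_)
  · refine PrimrecPred.exists_mem hS (PrimrecPred.and ?_ (PrimrecPred.and ?_ ?_))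
    · exact PrimrecPred.eq (h1.comp Primrec.snd) (Primrec.const 0)
    · exact PrimrecPred.eq (h2.comp Primrec.snd) (Primrec.const 0)
    · exact primrecPred_relates (hD.comp Primrec.fst) (hvs.comp Primrec.fst)
        (hC.comp Primrec.fst) (Primrec.const _) (Primrec.const _) (h3.comp Primrec.snd)
  · refine PrimrecPred.forall_mem hS (PrimrecPred.forall_mem (Primrec.const _)
      (PrimrecPred.exists_mem (hS.comp (Primrec.fst.comp Primrec.fst)) ?_))
    have hx : Primrec fun z : ((γ × LabelledState n) × Letter n) × LabelledState n =>
      z.1.1.1 := Primrec.fst.comp (Primrec.fst.comp Primrec.fst)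
    have hs : Primrec fun z : ((γ × LabelledState n) × Letter n) × LabelledState n =>
      z.1.1.2 := Primrec.snd.comp (Primrec.fst.comp Primrec.fst)
    have ha : Primrec fun z : ((γ × LabelledState n) × Letter n) × LabelledState n =>
      z.1.2 := Primrec.snd.comp Primrec.fst
    refine PrimrecPred.and ?_ (PrimrecPred.and ?_ ?_)
    · exact PrimrecPred.eq (h1.comp Primrec.snd)
        (FSACode.primrec_next (hM.comp hx) (h1.comp hs) ha)
    · exact PrimrecPred.eq (h2.comp Primrec.snd)
        (FSACode.primrec_next (primrec_wordAcceptor.comp (hD.comp hx)) (h2.comp hs) ha)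
    · exact primrecPred_relates (hD.comp hx) (hvs.comp hx) (hC.comp hx) (h3.comp hs)
        (Primrec.list_cons.comp ha (Primrec.const [])) (h3.comp Primrec.snd)
  · refine PrimrecPred.forall_mem hS ?_
    have himp := (PrimrecPred.mem (h1.comp Primrec.snd)
      (FSACode.primrec_accepting.comp (hM.comp Primrec.fst))).not.or
      ((PrimrecPred.mem (h2.comp Primrec.snd) (FSACode.primrec_accepting.comp
        (primrec_wordAcceptor.comp (hD.comp Primrec.fst)))).and
      (primrecPred_relates (hD.comp Primrec.fst) (hvs.comp Primrec.fst)
        (hC.comp Primrec.fst) (h3.comp (Primrec.snd (α := γ))) (Primrec.const [])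
        (Primrec.const [[]])))
    exact himp.of_eq fun z => imp_iff_not_or.symm

theorem primrecPred_isEdge {D : γ → AutomaticData n} {e : γ → Edge n} (hD : Primrec D)
    (he : Primrec e) : PrimrecPred fun x => (D x).IsEdge (e x) := by
  have hP : Primrec fun x => (e x).1 := Primrec.fst.comp he
  have hA : Primrec fun x => (D x).letterAut (e x).2.1 :=
    primrec_letterAut hD (Primrec.fst.comp (Primrec.snd.comp he))
  have hQ : Primrec fun x => (e x).2.2.1 :=
    Primrec.fst.comp (Primrec.snd.comp (Primrec.snd.comp he))
  have hI : Primrec fun x => (e x).2.2.2 :=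
    Primrec.snd.comp (Primrec.snd.comp (Primrec.snd.comp he))
  have h1 : Primrec fun s : ℕ × ℕ × ℕ => s.1 := Primrec.fst
  have h2 : Primrec fun s : ℕ × ℕ × ℕ => s.2.1 := Primrec.fst.comp Primrec.snd
  have h3 : Primrec fun s : ℕ × ℕ × ℕ => s.2.2 := Primrec.snd.comp Primrec.snd
  refine PrimrecPred.and (PrimrecPred.mem (Primrec.const _) hI) (PrimrecPred.and ?_ ?_)
  · refine PrimrecPred.forall_mem hI (PrimrecPred.forall_mem (Primrec.const _) ?_)
    have hx : Primrec fun z : (γ × ℕ × ℕ × ℕ) × Option (Letter n) × Option (Letter n) =>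
      z.1.1 := Primrec.fst.comp Primrec.fst
    have hs : Primrec fun z : (γ × ℕ × ℕ × ℕ) × Option (Letter n) × Option (Letter n) =>
      z.1.2 := Primrec.snd.comp Primrec.fst
    exact PrimrecPred.mem (Primrec.pair
      (FSACode.primrec_tapeNext (hP.comp hx) (h1.comp hs) (Primrec.fst.comp Primrec.snd))
      (Primrec.pair (FSACode.primrec_next (hA.comp hx) (h2.comp hs) Primrec.snd)
        (FSACode.primrec_tapeNext (hQ.comp hx) (h3.comp hs) (Primrec.snd.comp Primrec.snd))))
      (hI.comp hx)
  · refine PrimrecPred.forall_mem hI ?_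
    have himp := (PrimrecPred.mem (h1.comp Primrec.snd)
      (FSACode.primrec_accepting.comp (hP.comp Primrec.fst))).not.or
      ((PrimrecPred.mem (h2.comp Primrec.snd)
        (FSACode.primrec_accepting.comp (hA.comp Primrec.fst))).not.or
      (PrimrecPred.mem (h3.comp Primrec.snd)
        (FSACode.primrec_accepting.comp (hQ.comp (Primrec.fst (α := γ))))))
    exact himp.of_eq fun z => by rw [imp_iff_not_or, imp_iff_not_or]

theorem primrec_sources {E : γ → List (Edge n)} {a : γ → Letter n}
    {S : γ → List (FSACode (Letter n))} (hE : Primrec E) (ha : Primrec a) (hS : Primrec S) :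
    Primrec fun x => sources (E x) (a x) (S x) := by
  classical
  have he : Primrec fun z : γ × Edge n => z.2 := Primrec.snd
  have hcond := (PrimrecPred.eq (Primrec.fst.comp (Primrec.snd.comp he))
    (ha.comp (Primrec.fst (β := Edge n)))).and
    (PrimrecPred.mem (Primrec.fst.comp (Primrec.snd.comp (Primrec.snd.comp he)))
      (hS.comp Primrec.fst))
  exact Primrec.listFilterMap hE (Primrec.ite hcond
    (Primrec.option_some.comp (Primrec.fst.comp he)) (Primrec.const none)).to₂

theorem primrec_pathSources {E : γ → List (Edge n)} {M : γ → FSACode (Letter n)}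
    {v : γ → GWord n} (hE : Primrec E) (hM : Primrec M) (hv : Primrec v) :
    Primrec fun x => pathSources (E x) (M x) (v x) :=
  Primrec.list_foldr hv (Primrec.list_cons.comp hM (Primrec.const []))
    (primrec_sources (hE.comp Primrec.fst) (Primrec.fst.comp Primrec.snd)
      (Primrec.snd.comp Primrec.snd)).to₂

theorem primrecPred_certifies {D : γ → AutomaticData n} {vs : γ → List (GWord n)}
    {M : γ → FSACode (Letter n)} {c : γ → Certificate n} (hD : Primrec D) (hvs : Primrec vs)
    (hM : Primrec M) (hc : Primrec c) :
    PrimrecPred fun x => (D x).Certifies (vs x) (M x) (c x) := by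
  have hc2 : Primrec fun x => (c x).2.2 := Primrec.snd.comp (Primrec.snd.comp hc)
  have hE : Primrec fun x => (c x).2.2.2 := Primrec.snd.comp hc2
  refine PrimrecPred.and ?_ (PrimrecPred.and ?_ (PrimrecPred.and ?_ ?_))
  · exact primrecPred_isLabelling hD hvs hM (Primrec.fst.comp hc)
      (Primrec.fst.comp (Primrec.snd.comp hc))
  · exact PrimrecPred.mem (FSACode.primrec_run hM (Primrec.fst.comp hc2))
      (FSACode.primrec_accepting.comp hM)
  · exact PrimrecPred.forall_mem hE (primrecPred_isEdge (hD.comp Primrec.fst) Primrec.snd)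
  · exact PrimrecPred.forall_mem (primrec_symmetrize.comp hvs)
      (PrimrecPred.mem (hM.comp Primrec.fst)
        (primrec_pathSources (hE.comp Primrec.fst) (hM.comp Primrec.fst) Primrec.snd))

/-! ### The search for a certificate -/

open Classical in
/-- Decodes a number as a pair of an automaton and a certificate, and returns the automaton if the
certificate is valid for it. -/
noncomputable def certifiedCode (p : AutomaticData n × List (GWord n)) (k : ℕ) :
    Option (FSACode (Letter n)) :=
  (Encodable.decode (α := FSACode (Letter n) × Certificate n) k).bind fun c =>
    if p.1.Certifies p.2 c.1 c.2 then some c.1 else none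

theorem primrec_certifiedCode :
    Primrec₂ (certifiedCode : AutomaticData n × List (GWord n) → ℕ → Option _) := by
  classical
  have hx : Primrec fun z : ((AutomaticData n × List (GWord n)) × ℕ) ×
      (FSACode (Letter n) × Certificate n) => z.1.1 := Primrec.fst.comp Primrec.fst
  have hc : Primrec fun z : ((AutomaticData n × List (GWord n)) × ℕ) ×
      (FSACode (Letter n) × Certificate n) => z.2 := Primrec.snd
  have hcert := primrecPred_certifies (Primrec.fst.comp hx) (Primrec.snd.comp hx)
    (Primrec.fst.comp hc) (Primrec.snd.comp hc)
  have hdec : Primrec fun z : (AutomaticData n × List (GWord n)) × ℕ =>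
      (Encodable.decode z.2 : Option (FSACode (Letter n) × Certificate n)) :=
    Primrec.decode.comp Primrec.snd
  have hite := Primrec.ite hcert (Primrec.option_some.comp (Primrec.fst.comp hc))
    (Primrec.const none)
  exact Primrec.option_bind hdec hite.to₂

theorem certifies_of_certifiedCode_eq {p : AutomaticData n × List (GWord n)} {k : ℕ}
    {M : FSACode (Letter n)} (h : certifiedCode p k = some M) : ∃ c, p.1.Certifies p.2 M c := by
  obtain ⟨⟨M', c⟩, -, hc⟩ := Option.bind_eq_some_iff.1 h
  split_ifs at hc with hcert
  obtain rfl := Option.some.inj hc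
  exact ⟨c, hcert⟩

theorem Certifies.certifiedCode_eq {D : AutomaticData n} {vs : List (GWord n)}
    {M : FSACode (Letter n)} {c : Certificate n} (h : D.Certifies vs M c) :
    certifiedCode (D, vs) (Encodable.encode (M, c)) = some M := by
  rw [certifiedCode, Encodable.encodek, Option.bind_some, if_pos h]

end AutomaticData

/-- For each number `n` of generators there is one partial recursive function which, applied to
the finite presentation, the automatic structure with uniqueness and words generating `H`,
(a) halts with an automaton recognizing `L_H` when `H` is `L`-rational, and
(b) does not halt when `H` is not `L`-rational. -/
theorem proposition1 (n : ℕ) :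
    ∃ f : AutomaticData n × List (GWord n) →. FSACode (Letter n),
      Partrec f ∧
      ∀ D : AutomaticData n, D.IsAutomaticWithUniqueness →
        ∀ vs : List (GWord n),
          (D.IsRational (D.subgroupOf vs) →
            ∃ MH ∈ f (D, vs), MH.language = D.preimageLang (D.subgroupOf vs)) ∧
          (¬ D.IsRational (D.subgroupOf vs) → ¬ (f (D, vs)).Dom) := by
  refine ⟨fun p => Nat.rfindOpt (AutomaticData.certifiedCode p),
    Partrec.rfindOpt AutomaticData.primrec_certifiedCode.to_comp, fun D hD vs => ?_⟩
  have sound : ∀ M ∈ Nat.rfindOpt (AutomaticData.certifiedCode (D, vs)),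
      M.language = D.preimageLang (D.subgroupOf vs) := by
    intro M hM
    obtain ⟨k, hk⟩ := Nat.rfindOpt_spec hM
    obtain ⟨c, hc⟩ := AutomaticData.certifies_of_certifiedCode_eq hk
    exact hc.language_eq hD
  constructor
  · intro hH
    obtain ⟨M, c, hc⟩ := AutomaticData.exists_certifies hD hH
    have hdom : (Nat.rfindOpt (AutomaticData.certifiedCode (D, vs))).Dom :=
      Nat.rfindOpt_dom.2 ⟨_, M, hc.certifiedCode_eq⟩
    exact ⟨_, Part.get_mem hdom, sound _ (Part.get_mem hdom)⟩
  · intro hH hdom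
    refine hH ?_
    rw [AutomaticData.IsRational, ← sound _ (Part.get_mem hdom)]
    exact FSACode.isRegular_language _
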